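/- **Theorem 2.2.** Let $w\ge 0$ be an even integer and let $\varphi_1,\dots,\varphi_r$ be a basis of the space of cusp forms of weight $w+2$ for $PSL(2,\mathbf Z)$. Let $A_1,\dots,A_r$ be independent associative non-commuting formal variables, and let $\mathbf G=1+(A_1,\dots,A_r)$ be the multiplicative group of all series with constant term $1$ in $\mathbf C\langle\langle A_1,\dots,A_r\rangle\rangle$. Put $W=\{(p,q)\in\mathbf Z^2:\gcd(p,q)=1\}$ and, for $(p,q)\in W$, $$\Omega(p,q)=\sum_{j=1}^r A_j\,\omega_j,\qquad \omega_j=\varphi_j(z)(pz-q)^w\,dz .$$ For a rational number $a$ let $$J_a^{i\infty}(\Omega(p,q))=1+\sum_{n\ge1}\ \sum_{j_1,\dots,j_n}A_{j_1}\cdots A_{j_n}\int_a^{i\infty}\omega_{j_1}(z_1)\int_a^{z_1}\omega_{j_2}(z_2)\cdots\int_a^{z_{n-1}}\omega_{j_n}(z_n),$$ where all integrals are taken along the geodesic in the upper half-plane from $a$ to $i\infty$ (the vertical half-line above $a$); put also $J_{i\infty}^{i\infty}(\Omega(p,q))=1$. Then all these integrals converge absolutely. Define $f,\mathcal D:W\to\mathbf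 G$ by $$f(p,q)=J_0^{i\infty}(\Omega(p,q)),\qquad \mathcal D(p,q)=J_{q/p}^{i\infty}(\Omega(p,q)),$$ where $q/p$ means $i\infty$ if $p=0$. Then: 1. $f$ is a $\mathbf G$-valued reciprocity function, that is, for all $(p,q)\in W$, $$f(p,-q)=f(-p,q),\qquad f(p,q)\,f(-q,p)=1,\qquad f(p,p+q)\,f(p+q,q)=f(p,q).$$ 2. $\mathcal D$ is a generalized $\mathbf G$-valued Dedekind symbol with reciprocity function $f$, that is, for all $(p,q)\in W$, $$\mathcal D(p,q)=\mathcal D(p,q+p),\qquad \mathcal D(p,-q)=\mathcal D(-p,q),\qquad \mathcal D(p,q)\,\mathcal D(q,-p)^{-1}=f(p,q).$$ -/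

import Mathlib

open scoped MatrixGroups

noncomputable section

namespace NCDedekind

/-! ## Associative formal series in non-commuting variables -/

/-- The ring `R⟨⟨A_j : j ∈ σ⟩⟩` of associative formal series in non-commuting variables `A_j`.
A series is the family of its coefficients; the word `[j₁, …, jₙ]` stands for the monomial
`A_{j₁} ⋯ A_{jₙ}`, and `[]` for `1`. -/
def NCSeries (σ R : Type*) := List σ → R

namespace NCSeries

variable {σ R : Type*} [Ring R]

/-- The coefficient of a monomial. -/
def coeff (l : List σ) (f : NCSeries σ R) : R := f l

@[ext] theorem ext {f g : NCSeries σ R} (h : ∀ l, f.coeff l = g.coeff l) : f = g := funext h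

instance : AddCommGroup (NCSeries σ R) := inferInstanceAs (AddCommGroup (List σ → R))

instance : One (NCSeries σ R) := ⟨fun l => if l.length = 0 then 1 else 0⟩

/-- The product: the coefficient at a word `l` is the sum of `f(u) g(v)` over all ways of cutting
`l` into `u` followed by `v`. -/
instance : Mul (NCSeries σ R) :=
  ⟨fun f g l => ∑ i ∈ Finset.range (l.length + 1), f (l.take i) * g (l.drop i)⟩

theorem coeff_zero (l : List σ) : coeff l (0 : NCSeries σ R) = 0 := rfl

theorem coeff_add (f g : NCSeries σ R) (l : List σ) :
    coeff l (f + g) = coeff l f + coeff l g := rfl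

theorem coeff_one_nil : coeff [] (1 : NCSeries σ R) = 1 := rfl

theorem coeff_one_cons (a : σ) (l : List σ) : coeff (a :: l) (1 : NCSeries σ R) = 0 := rfl

theorem coeff_mul (f g : NCSeries σ R) (l : List σ) :
    coeff l (f * g) =
      ∑ i ∈ Finset.range (l.length + 1), coeff (l.take i) f * coeff (l.drop i) g := rfl

theorem coeff_mul_nil (f g : NCSeries σ R) :
    coeff [] (f * g) = coeff [] f * coeff [] g := by
  simp [coeff_mul]

/-- Removing the first letter of each monomial that starts with `a`. -/
def tail (a : σ) (f : NCSeries σ R) : NCSeries σ R := fun l => f (a :: l)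

theorem coeff_tail (a : σ) (f : NCSeries σ R) (l : List σ) :
    coeff l (tail a f) = coeff (a :: l) f := rfl

theorem coeff_mul_cons (f g : NCSeries σ R) (a : σ) (l : List σ) :
    coeff (a :: l) (f * g) = coeff [] f * coeff (a :: l) g + coeff l (tail a f * g) := by
  rw [coeff_mul, List.length_cons, Finset.sum_range_succ', add_comm]
  rfl

theorem mul_assoc_aux (l : List σ) (f g h : NCSeries σ R) :
    coeff l (f * g * h) = coeff l (f * (g * h)) := by
  induction l generalizing f g h with
  | nil => simp only [coeff_mul_nil, mul_assoc]
  | cons a l ih =>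
    have key : coeff l (tail a (f * g) * h)
        = coeff [] f * coeff l (tail a g * h) + coeff l (tail a f * g * h) := by
      simp only [coeff_mul (tail a (f * g)), coeff_mul (tail a g), coeff_mul (tail a f * g),
        coeff_tail, coeff_mul_cons f g, Finset.mul_sum, ← Finset.sum_add_distrib, add_mul,
        mul_assoc]
    rw [coeff_mul_cons (f * g), coeff_mul_cons f, coeff_mul_cons g, key, ih, coeff_mul_nil]
    simp only [mul_add, mul_assoc, add_assoc]

theorem one_mul_aux (f : NCSeries σ R) : 1 * f = f := by
  ext l
  rw [coeff_mul, Finset.sum_range_succ']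
  rw [Finset.sum_eq_zero]
  · simp [coeff_one_nil]
  · intro i hi
    cases l with
    | nil => simp at hi
    | cons a l => simp [coeff_one_cons]

theorem mul_one_aux (f : NCSeries σ R) : f * 1 = f := by
  ext l
  rw [coeff_mul, Finset.sum_range_succ, Finset.sum_eq_zero]
  · simp [coeff_one_nil]
  · intro i hi
    have hi' : i < l.length := Finset.mem_range.1 hi
    rw [List.drop_eq_getElem_cons hi', coeff_one_cons, mul_zero]

instance : Ring (NCSeries σ R) :=
  { (inferInstance : AddCommGroup (NCSeries σ R)) with
    mul := (· * ·)
    one := 1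
    mul_assoc := fun f g h => ext fun l => mul_assoc_aux l f g h
    one_mul := one_mul_aux
    mul_one := mul_one_aux
    left_distrib := fun f g h => ext fun l => by
      simp only [coeff_add, coeff_mul, mul_add, Finset.sum_add_distrib]
    right_distrib := fun f g h => ext fun l => by
      simp only [coeff_add, coeff_mul, add_mul, Finset.sum_add_distrib]
    zero_mul := fun f => ext fun l => by simp [coeff_mul, coeff_zero]
    mul_zero := fun f => ext fun l => by simp [coeff_mul, coeff_zero] }

variable (σ R) in
/-- The multiplicative group `1 + (A_j : j ∈ σ)` of the series with constant term `1`. -/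
def unipotent : Submonoid (NCSeries σ R) where
  carrier := {f | f.coeff [] = 1}
  one_mem' := coeff_one_nil
  mul_mem' := by
    intro f g hf hg
    change coeff [] (f * g) = 1
    rw [coeff_mul_nil, show coeff [] f = 1 from hf, show coeff [] g = 1 from hg, one_mul]

/-- Coefficients of the right inverse of a series with constant term `1`. -/
def invCoeff (f : NCSeries σ R) : List σ → R
  | [] => 1
  | a :: l => -∑ i ∈ Finset.range (l.length + 1),
      f.coeff (a :: l.take i) * invCoeff f (l.drop i)
  termination_by l => l.length
  decreasing_by simp only [List.length_drop, List.length_cons]; omega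

/-- The inverse of a series with constant term `1`. -/
def inv (f : NCSeries σ R) : NCSeries σ R := fun l => invCoeff f l

theorem mul_inv_aux (f : NCSeries σ R) (hf : f.coeff [] = 1) : f * inv f = 1 := by
  ext l
  cases l with
  | nil =>
    have : coeff [] (inv f) = 1 := by simp [coeff, inv, invCoeff]
    rw [coeff_mul_nil, hf, this, one_mul, coeff_one_nil]
  | cons a l =>
    have : coeff (a :: l) (inv f) = -coeff l (tail a f * inv f) := by
      rw [coeff, inv, invCoeff]
      rfl
    rw [coeff_mul_cons, hf, this, one_mul, neg_add_cancel, coeff_one_cons]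

instance : Inv (unipotent σ R) :=
  ⟨fun f => ⟨inv f.1, by change invCoeff f.1 [] = 1; simp [invCoeff]⟩⟩

theorem unipotent_mul_inv (f : unipotent σ R) : f * f⁻¹ = 1 :=
  Subtype.ext (mul_inv_aux f.1 f.2)

instance : Group (unipotent σ R) :=
  { (inferInstance : Monoid (unipotent σ R)) with
    inv := (·⁻¹)
    inv_mul_cancel := fun f => by
      have h1 := unipotent_mul_inv f
      have h2 := unipotent_mul_inv f⁻¹
      calc f⁻¹ * f = f⁻¹ * f * (f⁻¹ * f⁻¹⁻¹) := by rw [h2, mul_one]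
        _ = f⁻¹ * (f * f⁻¹) * f⁻¹⁻¹ := by simp only [mul_assoc]
        _ = 1 := by rw [h1, mul_one, h2] }

end NCSeries

/-! ## Reciprocity functions and generalized Dedekind symbols -/

/-- The set `W` of pairs of coprime integers. -/
def W : Type := {x : ℤ × ℤ // Int.gcd x.1 x.2 = 1}

/-- The element `(p, q)` of `W`. -/
def W.mk (p q : ℤ) (h : Int.gcd p q = 1) : W := ⟨(p, q), h⟩

theorem gcd_neg_right {p q : ℤ} (h : Int.gcd p q = 1) : Int.gcd p (-q) = 1 := by simpa using h

theorem gcd_neg_left {p q : ℤ} (h : Int.gcd p q = 1) : Int.gcd (-p) q = 1 := by simpa using h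

theorem gcd_neg_swap {p q : ℤ} (h : Int.gcd p q = 1) : Int.gcd (-q) p = 1 := by
  simpa [Int.gcd_comm] using h

theorem gcd_swap_neg {p q : ℤ} (h : Int.gcd p q = 1) : Int.gcd q (-p) = 1 := by
  simpa [Int.gcd_comm] using h

theorem gcd_add_right {p q : ℤ} (h : Int.gcd p q = 1) : Int.gcd p (p + q) = 1 := by simpa using h

theorem gcd_add_right' {p q : ℤ} (h : Int.gcd p q = 1) : Int.gcd p (q + p) = 1 := by simpa using h

theorem gcd_add_left {p q : ℤ} (h : Int.gcd p q = 1) : Int.gcd (p + q) q = 1 := by simpa using h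

/-- `f : W → G` is a `G`-valued reciprocity function. -/
structure IsReciprocityFunction {G : Type*} [Group G] (f : W → G) : Prop where
  neg_right : ∀ (p q : ℤ) (h : Int.gcd p q = 1),
    f (W.mk p (-q) (gcd_neg_right h)) = f (W.mk (-p) q (gcd_neg_left h))
  mul_rot : ∀ (p q : ℤ) (h : Int.gcd p q = 1),
    f (W.mk p q h) * f (W.mk (-q) p (gcd_neg_swap h)) = 1
  mul_add : ∀ (p q : ℤ) (h : Int.gcd p q = 1),
    f (W.mk p (p + q) (gcd_add_right h)) * f (W.mk (p + q) q (gcd_add_left h)) = f (W.mk p q h)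

/-- `f` is a reciprocity function and `D : W → G` is a generalized `G`-valued Dedekind symbol with
reciprocity function `f`. -/
structure IsDedekindSymbol {G : Type*} [Group G] (f D : W → G) : Prop where
  isReciprocityFunction : IsReciprocityFunction f
  add_right : ∀ (p q : ℤ) (h : Int.gcd p q = 1),
    D (W.mk p q h) = D (W.mk p (q + p) (gcd_add_right' h))
  neg_right : ∀ (p q : ℤ) (h : Int.gcd p q = 1),
    D (W.mk p (-q) (gcd_neg_right h)) = D (W.mk (-p) q (gcd_neg_left h))
  reciprocity : ∀ (p q : ℤ) (h : Int.gcd p q = 1),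
    D (W.mk p q h) * (D (W.mk q (-p) (gcd_swap_neg h)))⁻¹ = f (W.mk p q h)

/-! ## Iterated integrals along the vertical geodesics

A family `ω : σ → ℂ → ℂ` stands for the `1`-form `Ω = ∑ j, A_j ω_j(z) dz` with values in formal
series. The geodesic of the upper half-plane from the cusp `x ∈ ℚ` to `i∞` is the vertical
half-line `t ↦ x + i t`, `0 < t < ∞`. -/

section Iterated

variable {σ : Type*}

/-- The pull-back `ω_j(x + i t) d(x + i t) / dt` of `ω_j(z) dz` to the geodesic from `x` to `i∞`. -/
def pullback (ω : σ → ℂ → ℂ) (x : ℚ) (j : σ) (t : ℝ) : ℂ :=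
  ω j ((x : ℂ) + Complex.I * (t : ℂ)) * Complex.I

/-- The iterated integral
`∫_x^z ω_{j₁}(z₁) dz₁ ∫_x^{z₁} ω_{j₂}(z₂) dz₂ ⋯ ∫_x^{z_{n-1}} ω_{jₙ}(zₙ) dzₙ`, `z = x + i T`,
along the geodesic, for the word `[j₁, …, jₙ]`. -/
def iterInt (ω : σ → ℂ → ℂ) (x : ℚ) : List σ → ℝ → ℂ
  | [], _ => 1
  | j :: l, T => ∫ t in Set.Ioc 0 T, pullback ω x j t * iterInt ω x l t

/-- The same iterated integral with upper limit `z = i∞`. -/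
def iterIntInfty (ω : σ → ℂ → ℂ) (x : ℚ) : List σ → ℂ
  | [] => 1
  | j :: l => ∫ t in Set.Ioi (0 : ℝ), pullback ω x j t * iterInt ω x l t

/-- All the integrals occurring in the iterated integrals from `x` to `i∞` converge absolutely. -/
def Converges (ω : σ → ℂ → ℂ) (x : ℚ) : Prop :=
  ∀ (j : σ) (l : List σ), MeasureTheory.IntegrableOn
    (fun t => pullback ω x j t * iterInt ω x l t) (Set.Ioi (0 : ℝ))

/-- `J_a^{i∞}(Ω) = ∑ A_{j₁} ⋯ A_{jₙ} ∫_a^{i∞} ω_{j₁} ∫_a^{z₁} ω_{j₂} ⋯`, the sum over all words,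
for a cusp `a` (`∞` being `i∞`); it is `1` for `a = i∞`. -/
def J (ω : σ → ℂ → ℂ) : OnePoint ℚ → NCSeries.unipotent σ ℂ
  | none => 1
  | some x => ⟨fun l => iterIntInfty ω x l, rfl⟩

end Iterated

/-! ## The series attached to cusp forms -/

section Symbols

variable {σ : Type*} {k : ℤ}

/-- The coefficients `φ_j(z) (p z - q)^w` of `Ω(p, q) = ∑ j, A_j φ_j(z) (p z - q)^w dz`. -/
def Omega (w : ℕ) (φ : σ → CuspForm 𝒮ℒ k) (p q : ℤ) (j : σ) (z : ℂ) : ℂ :=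
  φ j (UpperHalfPlane.ofComplex z) * ((p : ℂ) * z - (q : ℂ)) ^ w

/-- The cusp `q / p`, which is `i∞` for `p = 0`. -/
def cusp (p q : ℤ) : OnePoint ℚ :=
  if p = 0 then OnePoint.infty else (((q : ℚ) / (p : ℚ) : ℚ) : OnePoint ℚ)

/-- `f(p, q) = J_0^{i∞}(Ω(p, q))`. -/
def reciprocityFunction (w : ℕ) (φ : σ → CuspForm 𝒮ℒ k) (x : W) : NCSeries.unipotent σ ℂ :=
  J (Omega w φ x.1.1 x.1.2) ((0 : ℚ) : OnePoint ℚ)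

/-- `D(p, q) = J_{q/p}^{i∞}(Ω(p, q))`. -/
def dedekindSymbol (w : ℕ) (φ : σ → CuspForm 𝒮ℒ k) (x : W) : NCSeries.unipotent σ ℂ :=
  J (Omega w φ x.1.1 x.1.2) (cusp x.1.1 x.1.2)

end Symbols

end NCDedekind

end

/-! Both families of series come from one nonabelian cocycle of `SL(2, ℤ)`. Let `Φ_{p,q}` solve `dΦ
= Ω(p,q) Φ` on the upper half-plane with value `1` at `i∞`; it exists because cusp forms decay
exponentially (`exists_isSolution`). Solutions are unique up to right multiplication by constants
(`IsSolution.eq_mul_const`). For `γ` with rows `(a, b)`, `(c, d)`, weight `w + 2` makes `Ω(p,q)`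
pull back to `Ω(p',q')`, where `(p', q') = (pa - qc, qd - pb)` (`Omega_transform`). Hence
`Φ_{p',q'}(τ) = Φ_{p,q}(γτ) C_γ(p,q)` with `C_γ(p,q)` constant, and the chain rule for `γδ` is the
cocycle identity `cocycle_mul`.

Letting `τ → i∞`, the solution `Φ_{p,q} C_γ(p,q)` tends to `1` at `γ(i∞)` along the geodesic, and it
tends to `C_γ(p,q)` at `i∞`. Integrating it from the cusp gives `C_γ(p,q) = J_{γ(i∞)}^{i∞}(Ω(p,q))`
(`J_cusp`), convergence included. So `C_γ` depends only on the cusp `γ(i∞)` and is `1` when `γ`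
fixes `i∞`.

Thus `f` is the cocycle at `S`, and `D(p,q)` the cocycle at any `γ` with first column `(q, p)`. The
sign rules use that `w` is even; the other identities follow from the cocycle identity by comparing
cusps. -/

noncomputable section

namespace NCDedekind

open UpperHalfPlane Filter Topology MeasureTheory

/-! ### Decay on vertical strips, and primitives vanishing at `i∞` -/

/-- Exponential decay of order one at `i∞`, uniformly on vertical strips. -/
def StripDecay (h : ℂ → ℂ) : Prop :=
  ∀ R : ℝ, ∃ C : ℝ, ∀ z : ℂ, |z.re| ≤ R → 1 ≤ z.im → ‖h z‖ ≤ C * Real.exp (-z.im)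

/-- A function that differs from a constant by a decaying term is bounded on each strip. This keeps
the integrands of successive iterated integrals decaying. -/
theorem StripDecay.mul_of_sub_const {h F : ℂ → ℂ} {c : ℂ} (hh : StripDecay h)
    (hF : StripDecay fun z => F z - c) : StripDecay fun z => h z * F z := by
  intro R
  obtain ⟨C, hC⟩ := hh R
  obtain ⟨K, hK⟩ := hF R
  refine ⟨C * (|K| + ‖c‖), fun z hz hz1 => ?_⟩
  have h1 := hC z hz hz1
  have h2 : ‖F z‖ ≤ |K| + ‖c‖ := by
    have h3 : ‖F z - c‖ ≤ |K| := by
      refine (hK z hz hz1).trans ((mul_le_mul_of_nonneg_right (le_abs_self K)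
        (Real.exp_pos _).le).trans (mul_le_of_le_one_right (abs_nonneg K) ?_))
      rw [Real.exp_le_one_iff]
      linarith
    calc ‖F z‖ = ‖F z - c + c‖ := by rw [sub_add_cancel]
      _ ≤ ‖F z - c‖ + ‖c‖ := norm_add_le _ _
      _ ≤ |K| + ‖c‖ := by gcongr
  calc ‖h z * F z‖ = ‖h z‖ * ‖F z‖ := norm_mul _ _
    _ ≤ (C * Real.exp (-z.im)) * (|K| + ‖c‖) := by gcongr; exact (norm_nonneg _).trans h1
    _ = C * (|K| + ‖c‖) * Real.exp (-z.im) := by ring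

theorem vertical_re (x t : ℝ) : ((x : ℂ) + Complex.I * t).re = x := by simp

theorem vertical_im (x t : ℝ) : ((x : ℂ) + Complex.I * t).im = t := by simp

theorem StripDecay.isBigO {h : ℂ → ℂ} (hh : StripDecay h) (x : ℝ) :
    (fun t : ℝ => h (x + Complex.I * t)) =O[atTop] fun t => Real.exp (-t) := by
  obtain ⟨C, hC⟩ := hh |x|
  refine Asymptotics.IsBigO.of_bound C ?_
  filter_upwards [eventually_ge_atTop 1] with t ht
  have := hC (x + Complex.I * t) (by rw [vertical_re]) (by rwa [vertical_im])
  rw [vertical_im] at this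
  rwa [Real.norm_of_nonneg (Real.exp_pos _).le]

theorem StripDecay.tendsto {h : ℂ → ℂ} (hh : StripDecay h) (x : ℝ) :
    Tendsto (fun t : ℝ => h (x + Complex.I * t)) atTop (𝓝 0) :=
  (hh.isBigO x).trans_tendsto Real.tendsto_exp_neg_atTop_nhds_zero

theorem hasDerivAt_vertical (x t : ℝ) :
    HasDerivAt (fun t : ℝ => (x : ℂ) + Complex.I * t) Complex.I t := by
  simpa using ((Complex.ofRealCLM.hasDerivAt (x := t)).const_mul Complex.I).const_add (x : ℂ)

theorem HasDerivAt.comp_vertical {G : ℂ → ℂ} {g' : ℂ} {x t : ℝ}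
    (h : HasDerivAt G g' (x + Complex.I * t)) :
    HasDerivAt (fun t : ℝ => G (x + Complex.I * t)) (g' * Complex.I) t :=
  HasDerivAt.comp (h₂ := G) t h (hasDerivAt_vertical x t)

theorem continuousOn_vertical {h : ℂ → ℂ} (hh : ContinuousOn h {z : ℂ | 0 < z.im}) (x : ℝ) :
    ContinuousOn (fun t : ℝ => h (x + Complex.I * t)) (Set.Ioi 0) :=
  hh.comp (by fun_prop) fun t ht => by simpa using ht

/-- A holomorphic function on the upper half-plane that decays on vertical strips has a primitive
that decays in the same way. -/
theorem StripDecay.exists_primitive {h : ℂ → ℂ} (hd : DifferentiableOn ℂ h {z : ℂ | 0 < z.im})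
    (hh : StripDecay h) :
    ∃ G : ℂ → ℂ, (∀ z : ℂ, 0 < z.im → HasDerivAt G (h z) z) ∧ StripDecay G := by
  have hopen : IsOpen {z : ℂ | 0 < z.im} := isOpen_upperHalfPlaneSet
  obtain ⟨G, hG⟩ := (convex_halfSpace_im_gt 0).exists_forall_hasDerivWithinAt hd
  replace hG : ∀ z : ℂ, 0 < z.im → HasDerivAt G (h z) z := fun z hz =>
    (hG z hz).hasDerivAt (hopen.mem_nhds hz)
  have hint : ∀ x T : ℝ, 1 ≤ T →
      IntegrableOn (fun t : ℝ => h (x + Complex.I * t) * Complex.I) (Set.Ioi T) := by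
    intro x T hT
    have hc : ContinuousOn (fun t : ℝ => h (x + Complex.I * t) * Complex.I) (Set.Ici T) :=
      ((continuousOn_vertical hd.continuousOn x).mono fun t (ht : T ≤ t) =>
        show (0 : ℝ) < t by linarith).mul continuousOn_const
    refine (integrable_norm_iff ((hc.mono Set.Ioi_subset_Ici_self).aestronglyMeasurable
      measurableSet_Ioi)).1 (integrable_of_isBigO_exp_neg one_pos hc.norm ?_)
    simpa using hh.isBigO x
  have hder : ∀ x t : ℝ, 0 < t → HasDerivAt (fun t : ℝ => G (x + Complex.I * t))
      (h (x + Complex.I * t) * Complex.I) t := fun x t ht =>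
    HasDerivAt.comp_vertical (hG _ (by simpa using ht))
  have hlim : ∀ x : ℝ, ∃ L, Tendsto (fun t : ℝ => G (x + Complex.I * t)) atTop (𝓝 L) := fun x =>
    ⟨_, tendsto_limUnder_of_hasDerivAt_of_integrableOn_Ioi (a := 1)
      (fun t (ht : 1 < t) => hder x t (by linarith)) (hint x 1 le_rfl)⟩
  choose L hL using hlim
  -- The limits on different vertical lines agree: at height `t` the horizontal segment between the
  -- lines contributes at most `C * exp (-t) * |x|`.
  have hL0 : ∀ x, L x = L 0 := by
    intro x
    obtain ⟨C, hC⟩ := hh |x|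
    have hz : Tendsto (fun t : ℝ => G (x + Complex.I * t) - G ((0 : ℝ) + Complex.I * t)) atTop
        (𝓝 0) := by
      have hb : Tendsto (fun t : ℝ => C * Real.exp (-t) * |x|) atTop (𝓝 0) := by
        simpa using (Real.tendsto_exp_neg_atTop_nhds_zero.const_mul C).mul_const |x|
      refine squeeze_zero_norm' ?_ hb
      filter_upwards [eventually_ge_atTop 1] with t ht
      have := Convex.norm_image_sub_le_of_norm_hasDerivWithin_le (𝕜 := ℝ)
        (f := fun s : ℝ => G (s + Complex.I * t)) (f' := fun s : ℝ => h (s + Complex.I * t))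
        (s := Set.Icc (-|x|) |x|) (x := 0) (y := x) (C := C * Real.exp (-t)) ?_ ?_
        (convex_Icc _ _) ?_ ?_
      · simpa using this
      · intro s _
        refine HasDerivAt.hasDerivWithinAt ?_
        have h1 : HasDerivAt (fun s : ℝ => (s : ℂ) + Complex.I * t) 1 s := by
          simpa using (Complex.ofRealCLM.hasDerivAt (x := s)).add_const (Complex.I * t)
        have h2 := HasDerivAt.comp (h₂ := G) s
          (hG (s + Complex.I * t) (by rw [vertical_im]; linarith)) h1
        rwa [mul_one] at h2
      · intro s hs
        have := hC (s + Complex.I * t) (by rw [vertical_re]; exact abs_le.2 hs)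
          (by rwa [vertical_im])
        rwa [vertical_im] at this
      · exact ⟨by simp, by simp⟩
      · exact ⟨neg_abs_le x, le_abs_self x⟩
    have := tendsto_nhds_unique ((hL x).sub (hL 0)) hz
    exact sub_eq_zero.1 this
  refine ⟨fun z => G z - L 0, fun z hz => (hG z hz).sub_const _, fun R => ?_⟩
  obtain ⟨C, hC⟩ := hh R
  refine ⟨C, fun z hz hz1 => ?_⟩
  -- `L 0 - G z` is the integral of `h dz` up the vertical ray from `z`. Since `exp (-t)` integrates
  -- to `exp (-z.im)` there, the constant `C` is kept.
  have hI := integral_Ioi_of_hasDerivAt_of_tendsto'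
    (fun t (ht : z.im ≤ t) => hder z.re t (by linarith)) (hint z.re z.im hz1) (hL z.re)
  have hzz : (z.re : ℂ) + Complex.I * z.im = z := by rw [mul_comm]; exact Complex.re_add_im z
  rw [hL0, hzz] at hI
  rw [norm_sub_rev, ← hI, ← integral_exp_neg_Ioi, ← integral_const_mul]
  refine norm_integral_le_of_norm_le ((exp_neg_integrableOn_Ioi z.im one_pos).congr_fun
    (fun t _ => by simp) measurableSet_Ioi |>.const_mul C) ?_
  refine (ae_restrict_mem measurableSet_Ioi).mono fun t (ht : z.im < t) => ?_
  have := hC (z.re + Complex.I * t) (by rwa [vertical_re]) (by rw [vertical_im]; linarith)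
  rw [vertical_im] at this
  simpa using this

/-! ### Solutions of `dΦ = Ω Φ` on the upper half-plane -/

section Solutions

variable {σ : Type*}

/-- `Φ` is a solution of `dΦ = (∑ j, A_j ω_j dz) Φ` on the upper half-plane. -/
def IsSolution (ω : σ → ℂ → ℂ) (Φ : ℍ → NCSeries.unipotent σ ℂ) : Prop :=
  ∀ (j : σ) (l : List σ) (τ : ℍ),
    HasDerivAt (fun z : ℂ => (Φ (ofComplex z)).1.coeff (j :: l)) (ω j τ * (Φ τ).1.coeff l) τ

/-- `Φ` tends to `1` at `i∞`, exponentially on vertical strips. -/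
def IsNormalized (Φ : ℍ → NCSeries.unipotent σ ℂ) : Prop :=
  ∀ l : List σ, StripDecay fun z => (Φ (ofComplex z)).1.coeff l - (1 : NCSeries σ ℂ).coeff l

theorem NCSeries.unipotent_coeff_nil (f : NCSeries.unipotent σ ℂ) : f.1.coeff [] = 1 := f.2

open Classical in
/-- A primitive on the upper half-plane that decays on vertical strips, if there is one. -/
def decayingPrimitive (h : ℂ → ℂ) : ℂ → ℂ :=
  if hG : ∃ G : ℂ → ℂ, (∀ z : ℂ, 0 < z.im → HasDerivAt G (h z) z) ∧ StripDecay G then hG.choose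
  else 0

theorem decayingPrimitive_spec {h : ℂ → ℂ} (hd : DifferentiableOn ℂ h {z : ℂ | 0 < z.im})
    (hh : StripDecay h) :
    (∀ z : ℂ, 0 < z.im → HasDerivAt (decayingPrimitive h) (h z) z) ∧
      StripDecay (decayingPrimitive h) := by
  have hG := hh.exists_primitive hd
  rw [decayingPrimitive, dif_pos hG]
  exact hG.choose_spec

/-- The iterated integrals from `i∞`, as functions on the upper half-plane. -/
def iterPrimitive (ω : σ → ℂ → ℂ) : List σ → ℂ → ℂ
  | [] => fun _ => 1
  | j :: l => decayingPrimitive fun z => ω j z * iterPrimitive ω l z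

/-- Picard iteration terminates coefficientwise: each letter added to a word costs one integration
from `i∞`. -/
theorem exists_isSolution {ω : σ → ℂ → ℂ}
    (hd : ∀ j, DifferentiableOn ℂ (ω j) {z : ℂ | 0 < z.im}) (hω : ∀ j, StripDecay (ω j)) :
    ∃ Φ : ℍ → NCSeries.unipotent σ ℂ, IsSolution ω Φ ∧ IsNormalized Φ := by
  have key : ∀ l : List σ, DifferentiableOn ℂ (iterPrimitive ω l) {z : ℂ | 0 < z.im} ∧
      StripDecay fun z => iterPrimitive ω l z - (1 : NCSeries σ ℂ).coeff l := by
    intro l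
    induction l with
    | nil => exact ⟨differentiableOn_const _, fun R => ⟨0, by simp [iterPrimitive,
        NCSeries.coeff_one_nil]⟩⟩
    | cons j l ih =>
      have h := decayingPrimitive_spec ((hd j).mul ih.1) ((hω j).mul_of_sub_const ih.2)
      refine ⟨fun z hz => (h.1 z hz).differentiableAt.differentiableWithinAt, ?_⟩
      simpa [NCSeries.coeff_one_cons] using! h.2
  have key' : ∀ (j : σ) (l : List σ) (z : ℂ), 0 < z.im →
      HasDerivAt (iterPrimitive ω (j :: l)) (ω j z * iterPrimitive ω l z) z := fun j l =>
    (decayingPrimitive_spec ((hd j).mul (key l).1) ((hω j).mul_of_sub_const (key l).2)).1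
  refine ⟨fun τ => ⟨fun l => iterPrimitive ω l τ, rfl⟩, fun j l τ => ?_, fun l R => ?_⟩
  · refine (key' j l τ τ.im_pos).congr_of_eventuallyEq ?_
    filter_upwards [isOpen_upperHalfPlaneSet.mem_nhds τ.im_pos] with z hz
    change iterPrimitive ω (j :: l) (ofComplex z) = _
    rw [ofComplex_apply_of_im_pos hz]
  · obtain ⟨C, hC⟩ := (key l).2 R
    refine ⟨C, fun z hz hz1 => ?_⟩
    have := hC z hz hz1
    change ‖iterPrimitive ω l (ofComplex z) - _‖ ≤ _
    rwa [ofComplex_apply_of_im_pos (by linarith)]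

/-- `Ω` multiplies `Φ` on the left, so right multiplication by a constant commutes with the
equation. -/
theorem IsSolution.mul_const {ω : σ → ℂ → ℂ} {Φ : ℍ → NCSeries.unipotent σ ℂ}
    (h : IsSolution ω Φ) (C : NCSeries.unipotent σ ℂ) : IsSolution ω fun τ => Φ τ * C := by
  intro j l τ
  change HasDerivAt (fun z => NCSeries.coeff (j :: l) ((Φ (ofComplex z)).1 * C.1))
    (ω j τ * NCSeries.coeff l ((Φ τ).1 * C.1)) τ
  simp only [NCSeries.coeff_mul_cons, NCSeries.unipotent_coeff_nil, one_mul]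
  simp only [NCSeries.coeff_mul, NCSeries.coeff_tail, Finset.mul_sum, ← mul_assoc]
  exact (HasDerivAt.fun_sum fun i _ => (h j (l.take i) τ).mul_const _).const_add _

/-- By induction on the word, the derivatives of the two coefficients agree, so their difference is
constant on the connected half-plane. -/
theorem IsSolution.eq_of_eq {ω : σ → ℂ → ℂ} {Φ Ψ : ℍ → NCSeries.unipotent σ ℂ}
    (hΦ : IsSolution ω Φ) (hΨ : IsSolution ω Ψ) {τ₀ : ℍ} (h0 : Φ τ₀ = Ψ τ₀) (τ : ℍ) :
    Φ τ = Ψ τ := by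
  have key : ∀ (l : List σ) (τ : ℍ), (Φ τ).1.coeff l = (Ψ τ).1.coeff l := by
    intro l
    induction l with
    | nil => intro τ; rw [NCSeries.unipotent_coeff_nil, NCSeries.unipotent_coeff_nil]
    | cons j l ih =>
      intro τ
      have hD : ∀ z : ℂ, 0 < z.im → HasDerivAt (fun z : ℂ => (Φ (ofComplex z)).1.coeff (j :: l) -
          (Ψ (ofComplex z)).1.coeff (j :: l)) 0 z := by
        intro z hz
        have := (hΦ j l ⟨z, hz⟩).sub (hΨ j l ⟨z, hz⟩)
        rwa [ih, sub_self] at this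
      have hc := isOpen_upperHalfPlaneSet.is_const_of_deriv_eq_zero
        (convex_halfSpace_im_gt 0).isPreconnected
        (fun z hz => (hD z hz).differentiableAt.differentiableWithinAt)
        (fun z hz => (hD z hz).deriv) τ.im_pos τ₀.im_pos
      simp only [ofComplex_apply, h0, sub_self] at hc
      exact sub_eq_zero.1 hc
  exact Subtype.ext (NCSeries.ext fun l => key l τ)

theorem IsSolution.eq_mul_const {ω : σ → ℂ → ℂ} {Φ Ψ : ℍ → NCSeries.unipotent σ ℂ}
    (hΦ : IsSolution ω Φ) (hΨ : IsSolution ω Ψ) (τ₀ τ : ℍ) :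
    Φ τ = Ψ τ * ((Ψ τ₀)⁻¹ * Φ τ₀) :=
  hΦ.eq_of_eq (hΨ.mul_const _) (τ₀ := τ₀) (mul_inv_cancel_left _ _).symm τ

theorem IsSolution.continuousOn_coeff {ω : σ → ℂ → ℂ} {Φ : ℍ → NCSeries.unipotent σ ℂ}
    (h : IsSolution ω Φ) (l : List σ) :
    ContinuousOn (fun z : ℂ => (Φ (ofComplex z)).1.coeff l) {z : ℂ | 0 < z.im} := by
  cases l with
  | nil => simpa only [NCSeries.unipotent_coeff_nil] using continuousOn_const
  | cons j l => exact fun z hz => (h j l ⟨z, hz⟩).continuousAt.continuousWithinAt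

/-- If the coefficients of `F` tend to those of `1`, then those of `F * C` tend to those of
`C`. -/
theorem tendsto_coeff_mul_const {α : Type*} {u : Filter α} {F : α → NCSeries.unipotent σ ℂ}
    (hF : ∀ l, Tendsto (fun t => (F t).1.coeff l) u (𝓝 ((1 : NCSeries σ ℂ).coeff l)))
    (C : NCSeries.unipotent σ ℂ) (l : List σ) :
    Tendsto (fun t => (F t * C).1.coeff l) u (𝓝 (C.1.coeff l)) := by
  have h1 : C.1.coeff l = (1 * C.1).coeff l := by rw [one_mul]
  rw [h1, NCSeries.coeff_mul]
  change Tendsto (fun t => NCSeries.coeff l ((F t).1 * C.1)) u _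
  simp only [NCSeries.coeff_mul]
  exact tendsto_finsetSum _ fun i _ => (hF _).mul_const _

theorem IsNormalized.tendsto {Φ : ℍ → NCSeries.unipotent σ ℂ} (h : IsNormalized Φ) (x : ℝ)
    (l : List σ) : Tendsto (fun t : ℝ => (Φ (ofComplex (x + Complex.I * t))).1.coeff l) atTop
      (𝓝 ((1 : NCSeries σ ℂ).coeff l)) := by
  simpa using ((h l).tendsto x).add_const ((1 : NCSeries σ ℂ).coeff l)

end Solutions

/-! ### Iterated integrals along a vertical half-line -/

section Vertical

variable {σ : Type*}

theorem vertical_mem {t : ℝ} (x : ℝ) (ht : 0 < t) : 0 < ((x : ℂ) + Complex.I * t).im := by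
  rwa [vertical_im]

theorem pullback_eq (ω : σ → ℂ → ℂ) (x : ℚ) (j : σ) (t : ℝ) :
    pullback ω x j t = ω j (((x : ℝ) : ℂ) + Complex.I * t) * Complex.I := by
  rw [pullback, Complex.ofReal_ratCast]

theorem integrableOn_pullback_mul {ω : σ → ℂ → ℂ} {x : ℚ} {j : σ} {F : ℝ → ℂ} {a b : ℂ}
    (hω : ContinuousOn (ω j) {z : ℂ | 0 < z.im}) (hdec : StripDecay (ω j))
    (hω0 : Tendsto (pullback ω x j) (𝓝[>] 0) (𝓝 0)) (hF : ContinuousOn F (Set.Ioi 0))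
    (h0 : Tendsto F (𝓝[>] 0) (𝓝 a)) (hinf : Tendsto F atTop (𝓝 b)) :
    IntegrableOn (fun t => pullback ω x j t * F t) (Set.Ioi 0) := by
  have hc : ContinuousOn (fun t => pullback ω x j t * F t) (Set.Ioi 0) := by
    simp only [pullback_eq]
    exact ((continuousOn_vertical hω x).mul continuousOn_const).mul hF
  have hsm : StronglyMeasurableAtFilter (fun t => pullback ω x j t * F t) (𝓝[>] 0) :=
    ⟨Set.Ioi 0, self_mem_nhdsWithin, hc.aestronglyMeasurable measurableSet_Ioi⟩
  rw [integrableOn_Ioi_iff_integrableAtFilter_atTop_nhdsWithin]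
  -- Near `0` the integrand has a finite limit; near infinity it is `O(exp (-t))`; in between
  -- continuity suffices.
  refine ⟨⟨Set.Ioi 1, Ioi_mem_atTop 1, ?_⟩, (hω0.mul h0).integrableAtFilter hsm
    (Measure.finiteAt_nhdsWithin _ _ _), hc.locallyIntegrableOn measurableSet_Ioi⟩
  have hc1 : ContinuousOn (fun t => pullback ω x j t * F t) (Set.Ici 1) :=
    hc.mono fun t (ht : 1 ≤ t) => show (0 : ℝ) < t by linarith
  refine (integrable_norm_iff ((hc1.mono Set.Ioi_subset_Ici_self).aestronglyMeasurable
    measurableSet_Ioi)).1 (integrable_of_isBigO_exp_neg one_pos hc1.norm ?_)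
  have h1 : (fun t => pullback ω x j t) =O[atTop] fun t => Real.exp (-t) := by
    simp only [pullback_eq]
    simpa using ((hdec.isBigO x).mul (Asymptotics.isBigO_const_const Complex.I
      (one_ne_zero (α := ℝ)) atTop))
  simpa using (h1.mul (hinf.isBigO_one ℝ)).norm_left

/-- A solution whose coefficients tend to those of `1` at the cusp `x` computes the iterated
integrals from `x` along the vertical geodesic. -/
theorem IsSolution.converges_and_iterIntInfty_eq {ω : σ → ℂ → ℂ}
    {Φ : ℍ → NCSeries.unipotent σ ℂ} (hΦ : IsSolution ω Φ)
    (hω : ∀ j, ContinuousOn (ω j) {z : ℂ | 0 < z.im}) (hdec : ∀ j, StripDecay (ω j)) {x : ℚ}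
    (hω0 : ∀ j, Tendsto (pullback ω x j) (𝓝[>] 0) (𝓝 0)) {C : NCSeries.unipotent σ ℂ}
    (h0 : ∀ l, Tendsto (fun t : ℝ => (Φ (ofComplex ((x : ℝ) + Complex.I * t))).1.coeff l) (𝓝[>] 0)
      (𝓝 ((1 : NCSeries σ ℂ).coeff l)))
    (hinf : ∀ l, Tendsto (fun t : ℝ => (Φ (ofComplex ((x : ℝ) + Complex.I * t))).1.coeff l) atTop
      (𝓝 (C.1.coeff l))) :
    Converges ω x ∧ ∀ l, iterIntInfty ω x l = C.1.coeff l := by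
  set Ψ : List σ → ℝ → ℂ := fun l t => (Φ (ofComplex ((x : ℝ) + Complex.I * t))).1.coeff l with hΨ
  have hcont : ∀ l, ContinuousOn (Ψ l) (Set.Ioi 0) := fun l =>
    continuousOn_vertical (hΦ.continuousOn_coeff l) x
  have hint : ∀ j l, IntegrableOn (fun t => pullback ω x j t * Ψ l t) (Set.Ioi 0) := fun j l =>
    integrableOn_pullback_mul (hω j) (hdec j) (hω0 j) (hcont l) (h0 l) (hinf l)
  have hder : ∀ j l (t : ℝ), 0 < t → HasDerivAt (Ψ (j :: l)) (pullback ω x j t * Ψ l t) t := by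
    intro j l t ht
    have := HasDerivAt.comp_vertical (hΦ j l ⟨_, vertical_mem x ht⟩)
    rw [pullback_eq, mul_right_comm]
    simpa only [hΨ, ofComplex_apply_of_im_pos (vertical_mem (x : ℝ) ht)] using! this
  have hFTC : ∀ j l (T : ℝ), 0 < T →
      ∫ t in (0 : ℝ)..T, pullback ω x j t * Ψ l t = Ψ (j :: l) T := by
    intro j l T hT
    -- The boundary term at `0` is the coefficient of `1` at a nonempty word, which vanishes.
    rw [intervalIntegral.integral_eq_sub_of_hasDerivAt_of_tendsto hT
      (fun t ht => hder j l t ht.1)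
      ((intervalIntegrable_iff_integrableOn_Ioc_of_le hT.le).2
        ((hint j l).mono_set Set.Ioc_subset_Ioi_self)) (h0 (j :: l))
      ((hder j l T hT).continuousAt.tendsto.mono_left nhdsWithin_le_nhds),
      NCSeries.coeff_one_cons, sub_zero]
  have hiter : ∀ l (T : ℝ), 0 < T → iterInt ω x l T = Ψ l T := by
    intro l
    induction l with
    | nil => intro T _; exact (NCSeries.unipotent_coeff_nil _).symm
    | cons j l ih =>
      intro T hT
      rw [iterInt, ← hFTC j l T hT, intervalIntegral.integral_of_le hT.le]
      exact setIntegral_congr_fun measurableSet_Ioc fun t ht => by simp only [ih t ht.1]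
  refine ⟨fun j l => (hint j l).congr_fun (fun t ht => by simp only [hiter l t ht])
    measurableSet_Ioi, fun l => ?_⟩
  cases l with
  | nil => exact (NCSeries.unipotent_coeff_nil _).symm
  | cons j l =>
    rw [iterIntInfty, setIntegral_congr_fun (g := fun t => pullback ω x j t * Ψ l t)
      measurableSet_Ioi fun t ht => by simp only [hiter l t ht]]
    refine tendsto_nhds_unique (intervalIntegral_tendsto_integral_Ioi 0 (hint j l) tendsto_id)
      ((hinf (j :: l)).congr' ?_)
    filter_upwards [eventually_gt_atTop 0] with T hT
    exact (hFTC j l T hT).symm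

end Vertical

/-! ### The forms `Ω(p, q)` -/

section Forms

variable {σ : Type*}

theorem differentiableOn_Omega (w : ℕ) {k : ℤ} (φ : σ → CuspForm 𝒮ℒ k) (p q : ℤ) (j : σ) :
    DifferentiableOn ℂ (Omega w φ p q j) {z : ℂ | 0 < z.im} := by
  have h := UpperHalfPlane.mdifferentiable_iff.1 (CuspFormClass.holo (φ j))
  exact h.mul (by fun_prop)

theorem cuspForm_strip_bound {k : ℤ} (φ : CuspForm 𝒮ℒ k) (R : ℝ) :
    ∃ C : ℝ, ∀ z : ℂ, |z.re| ≤ R → 1 ≤ z.im →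
      ‖φ (ofComplex z)‖ ≤ C * Real.exp (-2 * Real.pi * z.im) := by
  obtain ⟨C, hC⟩ :=
    (CuspFormClass.exp_decay_atImInfty (h := 1) φ one_pos one_mem_strictPeriods_SL).bound
  obtain ⟨A, hA⟩ := (atImInfty_mem _).1 hC
  have hcont : ContinuousOn (fun z : ℂ => φ (ofComplex z)) {z : ℂ | 0 < z.im} :=
    (UpperHalfPlane.mdifferentiable_iff.1 (CuspFormClass.holo φ)).continuousOn
  have hK : IsCompact (Set.Icc (-R) R ×ℂ Set.Icc 1 A) := isCompact_Icc.reProdIm isCompact_Icc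
  obtain ⟨B, hB⟩ := hK.exists_bound_of_continuousOn (hcont.mono fun z hz =>
    show 0 < z.im by linarith [hz.2.1])
  -- `C` serves above height `A`; below it the compactness bound `B` is paid for by `exp (2πA)`.
  refine ⟨max C (B * Real.exp (2 * Real.pi * A)), fun z hz hz1 => ?_⟩
  have hz0 : 0 < z.im := by linarith
  rcases le_total A z.im with h | h
  · have h1 := hA ⟨z, hz0⟩ h
    simp only [Set.mem_ofPred_eq, div_one, Real.norm_eq_abs, Real.abs_exp] at h1
    rw [ofComplex_apply_of_im_pos hz0]
    exact h1.trans (mul_le_mul_of_nonneg_right (le_max_left _ _) (Real.exp_pos _).le)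
  · have h1 := hB z ⟨abs_le.1 hz, hz1, h⟩
    have hB0 : 0 ≤ B := (norm_nonneg _).trans h1
    calc _ ≤ B := h1
      _ ≤ B * Real.exp (2 * Real.pi * A) * Real.exp (-2 * Real.pi * z.im) := by
        rw [mul_assoc, ← Real.exp_add]
        refine le_mul_of_one_le_right hB0 (Real.one_le_exp ?_)
        nlinarith [Real.pi_pos]
      _ ≤ _ := mul_le_mul_of_nonneg_right (le_max_right _ _) (Real.exp_pos _).le

/-- The polynomial factor is at most `(M * z.im) ^ w`, and `z.im ^ w ≤ w! * exp z.im`. The cusp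
form's `exp (-2π z.im)` absorbs this with room to spare. -/
theorem stripDecay_Omega (w : ℕ) {k : ℤ} (φ : σ → CuspForm 𝒮ℒ k) (p q : ℤ) (j : σ) :
    StripDecay (Omega w φ p q j) := by
  intro R
  obtain ⟨C, hC⟩ := cuspForm_strip_bound (φ j) R
  set M : ℝ := |(p : ℝ)| * (R + 1) + |(q : ℝ)|
  refine ⟨C * (M ^ w * w.factorial), fun z hz hz1 => ?_⟩
  have hR : 0 ≤ R := (abs_nonneg _).trans hz
  have h1 : ‖(p : ℂ) * z - q‖ ≤ M * z.im := by
    have hzn : ‖z‖ ≤ R + z.im := (Complex.norm_le_abs_re_add_abs_im z).trans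
      (add_le_add hz (abs_of_nonneg (by linarith)).le)
    calc ‖(p : ℂ) * z - q‖ ≤ ‖(p : ℂ) * z‖ + ‖(q : ℂ)‖ := norm_sub_le _ _
      _ = |(p : ℝ)| * ‖z‖ + |(q : ℝ)| := by
        rw [norm_mul, Complex.norm_intCast, Complex.norm_intCast]
      _ ≤ |(p : ℝ)| * (R + z.im) + |(q : ℝ)| := by gcongr
      _ ≤ |(p : ℝ)| * ((R + 1) * z.im) + |(q : ℝ)| * z.im := by
        gcongr
        · nlinarith
        · exact le_mul_of_one_le_right (abs_nonneg _) hz1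
      _ = M * z.im := by ring
  have h2 : z.im ^ w ≤ w.factorial * Real.exp z.im := by
    have := Real.pow_div_factorial_le_exp z.im (by linarith) w
    rwa [div_le_iff₀' (by positivity)] at this
  have h3 := hC z hz hz1
  have hC0 : 0 ≤ C := by
    by_contra! h
    linarith [norm_nonneg (φ j (ofComplex z)), mul_neg_of_neg_of_pos h
      (Real.exp_pos (-2 * Real.pi * z.im))]
  have hM : 0 ≤ M := by positivity
  calc ‖Omega w φ p q j z‖ = ‖φ j (ofComplex z)‖ * ‖(p : ℂ) * z - q‖ ^ w := by
        rw [Omega, norm_mul, norm_pow]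
    _ ≤ (C * Real.exp (-2 * Real.pi * z.im)) * (M * z.im) ^ w := by gcongr
    _ = C * Real.exp (-2 * Real.pi * z.im) * (M ^ w * z.im ^ w) := by rw [mul_pow]
    _ ≤ C * Real.exp (-2 * Real.pi * z.im) * (M ^ w * (w.factorial * Real.exp z.im)) := by gcongr
    _ = C * (M ^ w * w.factorial) * Real.exp (-2 * Real.pi * z.im + z.im) := by
        rw [Real.exp_add]; ring
    _ ≤ C * (M ^ w * w.factorial) * Real.exp (-z.im) := by
        gcongr
        nlinarith [Real.pi_gt_three]

variable {w : ℕ} (φ : σ → CuspForm 𝒮ℒ ((w : ℤ) + 2))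

theorem smul_denom_ne_zero (γ : SL(2, ℤ)) (τ : ℍ) :
    ((γ 1 0 : ℤ) : ℂ) * τ + (γ 1 1 : ℤ) ≠ 0 := by
  rw [← ModularGroup.denom_apply]
  exact denom_ne_zero _ _

theorem hasDerivAt_smul (γ : SL(2, ℤ)) (τ : ℍ) :
    HasDerivAt (fun z : ℂ => ((γ • ofComplex z : ℍ) : ℂ))
      (1 / (((γ 1 0 : ℤ) : ℂ) * τ + (γ 1 1 : ℤ)) ^ 2) τ := by
  have hdet : ((γ : GL (Fin 2) ℝ) : Matrix (Fin 2) (Fin 2) ℝ).det = 1 :=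
    Matrix.SpecialLinearGroup.det_coe _
  have h := (hasStrictDerivAt_smul (g := (γ : GL (Fin 2) ℝ)) (by rw [hdet]; exact one_pos)
    τ).hasDerivAt
  rw [hdet, ModularGroup.denom_apply, Complex.ofReal_one] at h
  exact h

/-- Modularity gives `(cτ + d) ^ (w + 2)` and the linear factor gives `(cτ + d) ^ (-w)`. The
remaining square cancels against the derivative of `τ ↦ γτ`. -/
theorem Omega_transform (γ : SL(2, ℤ)) (p q : ℤ) (j : σ) (τ : ℍ) :
    Omega w φ p q j (γ • τ : ℍ) =
      Omega w φ (p * γ 0 0 - q * γ 1 0) (q * γ 1 1 - p * γ 0 1) j τ *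
        (γ 1 0 * τ + γ 1 1) ^ 2 := by
  have hd := smul_denom_ne_zero γ τ
  have hφ : φ j (γ • τ) = ((γ 1 0 : ℤ) * (τ : ℂ) + (γ 1 1 : ℤ)) ^ (w + 2) * φ j τ := by
    have h := SlashInvariantForm.slash_action_eqn'' (φ j) (γ := (γ : GL (Fin 2) ℝ))
      (MonoidHom.mem_range.2 ⟨γ, rfl⟩) τ
    rw [ModularGroup.denom_apply] at h
    exact_mod_cast h
  have hq : (p : ℂ) * (((γ 0 0 : ℤ) * (τ : ℂ) + (γ 0 1 : ℤ)) /
        ((γ 1 0 : ℤ) * (τ : ℂ) + (γ 1 1 : ℤ))) - q =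
      ((p * γ 0 0 - q * γ 1 0 : ℤ) * (τ : ℂ) - (q * γ 1 1 - p * γ 0 1 : ℤ)) /
        ((γ 1 0 : ℤ) * (τ : ℂ) + (γ 1 1 : ℤ)) := by
    rw [eq_div_iff hd, sub_mul, mul_assoc, div_mul_cancel₀ _ hd]
    push_cast
    ring
  simp only [Omega, ofComplex_apply, hφ]
  rw [coe_specialLinearGroup_apply]
  simp only [eq_intCast, Complex.ofReal_intCast]
  rw [hq, div_pow]
  generalize ((γ 1 0 : ℤ) : ℂ) * τ + (γ 1 1 : ℤ) = D at hd
  field_simp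
  ring

theorem IsSolution.comp_smul {p q : ℤ} {Φ : ℍ → NCSeries.unipotent σ ℂ}
    (h : IsSolution (Omega w φ p q) Φ) (γ : SL(2, ℤ)) :
    IsSolution (Omega w φ (p * γ 0 0 - q * γ 1 0) (q * γ 1 1 - p * γ 0 1))
      fun τ => Φ (γ • τ) := by
  intro j l τ
  have h3 := HasDerivAt.comp_of_eq (τ : ℂ) (h j l (γ • τ)) (hasDerivAt_smul γ τ)
    (by rw [ofComplex_apply])
  have hd := smul_denom_ne_zero γ τ
  refine (h3.congr_of_eventuallyEq (.of_forall fun z => ?_)).congr_deriv ?_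
  · simp only [Function.comp_apply, ofComplex_apply]
  · rw [Omega_transform]
    generalize ((γ 1 0 : ℤ) : ℂ) * τ + (γ 1 1 : ℤ) = D at hd
    field_simp

end Forms

/-! ### The cocycle of regularized period series -/

section Cocycle

variable {σ : Type*} {w : ℕ} (φ : σ → CuspForm 𝒮ℒ ((w : ℤ) + 2))

/-- The solution of `dΦ = Ω(p, q) Φ` with value `1` at `i∞`. -/
def normalizedSolution (p q : ℤ) : ℍ → NCSeries.unipotent σ ℂ :=
  (exists_isSolution (differentiableOn_Omega w φ p q) (stripDecay_Omega w φ p q)).choose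

theorem isSolution_normalizedSolution (p q : ℤ) :
    IsSolution (Omega w φ p q) (normalizedSolution φ p q) :=
  (exists_isSolution (differentiableOn_Omega w φ p q) (stripDecay_Omega w φ p q)).choose_spec.1

theorem isNormalized_normalizedSolution (p q : ℤ) : IsNormalized (normalizedSolution φ p q) :=
  (exists_isSolution (differentiableOn_Omega w φ p q) (stripDecay_Omega w φ p q)).choose_spec.2

/-- The series `J_{γ(i∞)}^{i∞}(Ω(p, q))`, as the constant relating two normalized solutions. -/
def cocycle (γ : SL(2, ℤ)) (p q : ℤ) : NCSeries.unipotent σ ℂ :=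
  (normalizedSolution φ p q (γ • I))⁻¹ *
    normalizedSolution φ (p * γ 0 0 - q * γ 1 0) (q * γ 1 1 - p * γ 0 1) I

theorem normalizedSolution_eq (γ : SL(2, ℤ)) (p q : ℤ) (τ : ℍ) :
    normalizedSolution φ (p * γ 0 0 - q * γ 1 0) (q * γ 1 1 - p * γ 0 1) τ =
      normalizedSolution φ p q (γ • τ) * cocycle φ γ p q :=
  (isSolution_normalizedSolution φ _ _).eq_mul_const
    ((isSolution_normalizedSolution φ p q).comp_smul φ γ) I τ

theorem cocycle_mul (γ δ : SL(2, ℤ)) {p q p' q' : ℤ} (hp : p' = p * γ 0 0 - q * γ 1 0)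
    (hq : q' = q * γ 1 1 - p * γ 0 1) :
    cocycle φ (γ * δ) p q = cocycle φ γ p q * cocycle φ δ p' q' := by
  have h1 := normalizedSolution_eq φ γ p q (δ • I)
  have h2 := normalizedSolution_eq φ δ p' q' I
  rw [← hp, ← hq] at h1
  have hp' : p * (γ * δ) 0 0 - q * (γ * δ) 1 0 = p' * δ 0 0 - q' * δ 1 0 := by
    simp only [Matrix.SpecialLinearGroup.coe_mul, Matrix.mul_apply, Fin.sum_univ_two, hp, hq]
    ring
  have hq' : q * (γ * δ) 1 1 - p * (γ * δ) 0 1 = q' * δ 1 1 - p' * δ 0 1 := by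
    simp only [Matrix.SpecialLinearGroup.coe_mul, Matrix.mul_apply, Fin.sum_univ_two, hp, hq]
    ring
  rw [cocycle, hp', hq', h2, h1, mul_smul, mul_assoc, inv_mul_cancel_left]

theorem cocycle_eq_one {γ : SL(2, ℤ)} (hγ : γ 1 0 = 0) (p q : ℤ) : cocycle φ γ p q = 1 := by
  obtain ⟨n, hn⟩ := ModularGroup.exists_eq_T_zpow_of_c_eq_zero hγ
  -- `γ` acts as translation by `n`, so the vertical line above `0` goes to the one above `n`. Both
  -- solutions tend to `1` there, which forces the constant to be `1`.
  have hlim := tendsto_coeff_mul_const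
    ((isNormalized_normalizedSolution φ p q).tendsto (n : ℝ)) (cocycle φ γ p q)
  have heq : ∀ᶠ t : ℝ in atTop,
      normalizedSolution φ (p * γ 0 0 - q * γ 1 0) (q * γ 1 1 - p * γ 0 1)
        (ofComplex ((0 : ℝ) + Complex.I * t)) =
      normalizedSolution φ p q (ofComplex ((n : ℝ) + Complex.I * t)) * cocycle φ γ p q := by
    filter_upwards [eventually_gt_atTop 0] with t ht
    rw [normalizedSolution_eq, hn]
    congr 2
    ext
    rw [ModularGroup.coe_T_zpow_smul_eq, ofComplex_apply_of_im_pos (vertical_mem _ ht),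
      ofComplex_apply_of_im_pos (vertical_mem _ ht)]
    simp [add_comm]
  refine Subtype.ext (NCSeries.ext fun l => tendsto_nhds_unique (hlim l) ?_)
  refine ((isNormalized_normalizedSolution φ (p * γ 0 0 - q * γ 1 0)
    (q * γ 1 1 - p * γ 0 1)).tendsto 0 l).congr' ?_
  filter_upwards [heq] with t ht
  rw [ht]

/-! ### Identification of the cocycle with iterated integrals -/

theorem SL2_det (γ : SL(2, ℤ)) : γ 0 0 * γ 1 1 - γ 0 1 * γ 1 0 = 1 := by
  rw [← Matrix.det_fin_two]
  exact γ.det_coe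

/-- Points of the geodesic from `γ(i∞)` to `i∞` are images of points of a vertical half-line. -/
theorem smul_vertical {γ : SL(2, ℤ)} (hγ : γ 1 0 ≠ 0) {t : ℝ} (ht : 0 < t) :
    γ • ofComplex ((-(γ 1 1 : ℝ) / (γ 1 0 : ℝ) : ℝ) +
        Complex.I * (((γ 1 0 : ℝ) ^ 2 * t)⁻¹ : ℝ)) =
      ofComplex ((((γ 0 0 : ℚ) / (γ 1 0 : ℚ) : ℚ) : ℝ) + Complex.I * t) := by
  have hc : ((γ 1 0 : ℤ) : ℂ) ≠ 0 := by exact_mod_cast hγ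
  have hcR : ((γ 1 0 : ℤ) : ℝ) ≠ 0 := by exact_mod_cast hγ
  have htC : (t : ℂ) ≠ 0 := by exact_mod_cast ht.ne'
  have hdet : ((γ 0 0 : ℤ) : ℂ) * (γ 1 1 : ℤ) - (γ 0 1 : ℤ) * (γ 1 0 : ℤ) = 1 := by
    exact_mod_cast SL2_det γ
  have hs : 0 < ((γ 1 0 : ℝ) ^ 2 * t)⁻¹ := by positivity
  ext
  rw [coe_specialLinearGroup_apply, ofComplex_apply_of_im_pos (vertical_mem _ ht),
    ofComplex_apply_of_im_pos (vertical_mem _ hs)]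
  simp only [eq_intCast]
  push_cast
  generalize ((γ 0 0 : ℤ) : ℂ) = a at *
  generalize ((γ 0 1 : ℤ) : ℂ) = b at *
  generalize ((γ 1 0 : ℤ) : ℂ) = c at *
  generalize ((γ 1 1 : ℤ) : ℂ) = d at *
  have hden : c * (-d / c + Complex.I * (c ^ 2 * (t : ℂ))⁻¹) + d = Complex.I / (c * t) := by
    field_simp
    ring
  rw [hden, div_eq_iff (div_ne_zero Complex.I_ne_zero (mul_ne_zero hc htC))]
  field_simp
  linear_combination (-c * t) * hdet - c * t * Complex.I_sq

theorem tendsto_inv_sq_mul {c : ℝ} (hc : c ≠ 0) :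
    Tendsto (fun t : ℝ => (c ^ 2 * t)⁻¹) (𝓝[>] 0) atTop := by
  simp only [mul_inv]
  exact tendsto_inv_nhdsGT_zero.const_mul_atTop (by positivity)

/-- `γ` carries the geodesic near the cusp to large heights `s = 1/(c²t)`. There `cz + d = I c s`,
so the transformation factor is only quadratic in `s`, and exponential decay wins. -/
theorem tendsto_pullback_Omega {γ : SL(2, ℤ)} (hγ : γ 1 0 ≠ 0) (p q : ℤ) (j : σ) :
    Tendsto (pullback (Omega w φ p q) ((γ 0 0 : ℚ) / (γ 1 0 : ℚ)) j) (𝓝[>] 0) (𝓝 0) := by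
  have hcR : ((γ 1 0 : ℤ) : ℝ) ≠ 0 := by exact_mod_cast hγ
  set x' : ℝ := -(γ 1 1 : ℝ) / (γ 1 0 : ℝ)
  set ω' := Omega w φ (p * γ 0 0 - q * γ 1 0) (q * γ 1 1 - p * γ 0 1) j
  have h1 : Tendsto (fun s : ℝ => ω' (x' + Complex.I * s) * (s : ℂ) ^ 2) atTop (𝓝 0) := by
    have h2 : (fun s : ℝ => ω' (x' + Complex.I * s) * (s : ℂ) ^ 2) =O[atTop]
        fun s => Real.exp (-s) * s ^ 2 := by
      refine ((stripDecay_Omega w φ _ _ j).isBigO x').mul (.of_bound 1 (.of_forall fun s => ?_))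
      simp
    refine h2.trans_tendsto ?_
    simpa only [mul_comm] using Real.tendsto_pow_mul_exp_neg_atTop_nhds_zero 2
  have h3 := ((h1.comp (tendsto_inv_sq_mul hcR)).const_mul
    ((Complex.I * (γ 1 0 : ℤ)) ^ 2 * Complex.I))
  rw [mul_zero] at h3
  refine h3.congr' ?_
  filter_upwards [self_mem_nhdsWithin] with t (ht : 0 < t)
  have hs : 0 < ((γ 1 0 : ℝ) ^ 2 * t)⁻¹ := by positivity
  have h4 := Omega_transform φ γ p q j
    (ofComplex (x' + Complex.I * (((γ 1 0 : ℝ) ^ 2 * t)⁻¹ : ℝ)))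
  rw [smul_vertical hγ ht, ofComplex_apply_of_im_pos (vertical_mem _ ht),
    ofComplex_apply_of_im_pos (vertical_mem _ hs)] at h4
  have hden : ((γ 1 0 : ℤ) : ℂ) * (x' + Complex.I * (((γ 1 0 : ℝ) ^ 2 * t)⁻¹ : ℝ)) + (γ 1 1 : ℤ) =
      Complex.I * (γ 1 0 : ℤ) * (((γ 1 0 : ℝ) ^ 2 * t)⁻¹ : ℝ) := by
    have hc : ((γ 1 0 : ℤ) : ℂ) ≠ 0 := by exact_mod_cast hγ
    have hx' : ((γ 1 0 : ℤ) : ℂ) * (x' : ℂ) = -(γ 1 1 : ℤ) := by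
      simp only [x']
      push_cast
      field_simp
    rw [mul_add, hx']
    ring
  rw [pullback_eq]
  simp only [Function.comp_apply]
  change _ = Omega w φ p q j (_ : ℂ) * _
  rw [show ((((γ 0 0 : ℚ) / (γ 1 0 : ℚ) : ℚ) : ℝ) : ℂ) + Complex.I * t =
    ((⟨_, vertical_mem _ ht⟩ : ℍ) : ℂ) from rfl, h4]
  simp only [hden]
  ring

theorem converges_and_iterIntInfty_eq_cocycle {γ : SL(2, ℤ)} (hγ : γ 1 0 ≠ 0) (p q : ℤ) :
    Converges (Omega w φ p q) ((γ 0 0 : ℚ) / (γ 1 0 : ℚ)) ∧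
      ∀ l, iterIntInfty (Omega w φ p q) ((γ 0 0 : ℚ) / (γ 1 0 : ℚ)) l =
        (cocycle φ γ p q).1.coeff l := by
  have hcR : ((γ 1 0 : ℤ) : ℝ) ≠ 0 := by exact_mod_cast hγ
  refine ((isSolution_normalizedSolution φ p q).mul_const
    (cocycle φ γ p q)).converges_and_iterIntInfty_eq
    (fun j => (differentiableOn_Omega w φ p q j).continuousOn) (stripDecay_Omega w φ p q)
    (tendsto_pullback_Omega φ hγ p q) (fun l => ?_)
    (tendsto_coeff_mul_const ((isNormalized_normalizedSolution φ p q).tendsto _) _)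
  -- At the cusp, `Φ_{p,q} C_γ` is `Φ_{p',q'}` evaluated high on the line above `-d/c`, hence tends
  -- to `1`.
  refine (((isNormalized_normalizedSolution φ (p * γ 0 0 - q * γ 1 0)
    (q * γ 1 1 - p * γ 0 1)).tendsto (-(γ 1 1 : ℝ) / (γ 1 0 : ℝ)) l).comp
    (tendsto_inv_sq_mul hcR)).congr' ?_
  filter_upwards [self_mem_nhdsWithin] with t (ht : 0 < t)
  rw [← smul_vertical hγ ht, ← normalizedSolution_eq]
  rfl

theorem converges_Omega (p q : ℤ) (x : ℚ) : Converges (Omega w φ p q) x := by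
  have hx : IsCoprime x.num (x.den : ℤ) := by
    rw [Int.isCoprime_iff_gcd_eq_one]
    exact x.reduced
  obtain ⟨γ, h0, h1⟩ := hx.exists_SL2_col 0
  have hγ : γ 1 0 ≠ 0 := by
    rw [h1]
    exact_mod_cast x.den_nz
  have h := (converges_and_iterIntInfty_eq_cocycle φ hγ p q).1
  rwa [h0, h1, Int.cast_natCast, Rat.num_div_den] at h

theorem J_cusp (γ : SL(2, ℤ)) (p q : ℤ) :
    J (Omega w φ p q) (cusp (γ 1 0) (γ 0 0)) = cocycle φ γ p q := by
  by_cases hγ : γ 1 0 = 0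
  · rw [cocycle_eq_one φ hγ, cusp, if_pos hγ]
    rfl
  · rw [cusp, if_neg hγ]
    exact Subtype.ext (NCSeries.ext (converges_and_iterIntInfty_eq_cocycle φ hγ p q).2)

/-! ### The identities, read off from `S` and `T` -/

theorem reciprocityFunction_mk {p q : ℤ} (h : Int.gcd p q = 1) :
    reciprocityFunction w φ (W.mk p q h) = cocycle φ ModularGroup.S p q := by
  rw [← J_cusp]
  simp [ModularGroup.S, cusp, reciprocityFunction, W.mk]

theorem dedekindSymbol_mk {p q : ℤ} (h : Int.gcd p q = 1) {γ : SL(2, ℤ)} (h0 : γ 0 0 = q)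
    (h1 : γ 1 0 = p) : dedekindSymbol w φ (W.mk p q h) = cocycle φ γ p q := by
  rw [← J_cusp, h0, h1]
  rfl

theorem exists_SL2_of_gcd {p q : ℤ} (h : Int.gcd p q = 1) :
    ∃ γ : SL(2, ℤ), γ 0 0 = q ∧ γ 1 0 = p :=
  (Int.isCoprime_iff_gcd_eq_one.2 h).symm.exists_SL2_col 0

theorem Omega_neg_neg (hw : Even w) (p q : ℤ) : Omega w φ (-p) (-q) = Omega w φ p q := by
  funext j z
  rw [Omega, Omega, ← hw.neg_pow]
  push_cast
  ring_nf

theorem cusp_neg_neg (p q : ℤ) : cusp (-p) (-q) = cusp p q := by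
  simp [cusp]

theorem cocycle_neg_neg (hw : Even w) (γ : SL(2, ℤ)) (p q : ℤ) :
    cocycle φ γ (-p) (-q) = cocycle φ γ p q := by
  rw [← J_cusp, ← J_cusp, Omega_neg_neg φ hw]

/-- The cocycle depends only on the cusp `γ(i∞)`. -/
theorem cocycle_congr {γ δ : SL(2, ℤ)} (h0 : γ 0 0 = -δ 0 0) (h1 : γ 1 0 = -δ 1 0) (p q : ℤ) :
    cocycle φ γ p q = cocycle φ δ p q := by
  rw [← J_cusp, ← J_cusp, h0, h1, cusp_neg_neg]

theorem cocycle_T_mul (γ : SL(2, ℤ)) (p q : ℤ) :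
    cocycle φ (ModularGroup.T * γ) p (q + p) = cocycle φ γ p q := by
  rw [cocycle_mul φ (p' := p) (q' := q), cocycle_eq_one φ, one_mul] <;> simp [ModularGroup.coe_T]

theorem cocycle_T_inv_mul (γ : SL(2, ℤ)) (p q : ℤ) :
    cocycle φ (ModularGroup.T⁻¹ * γ) p q = cocycle φ γ p (q + p) := by
  rw [cocycle_mul φ (p' := p) (q' := q + p), cocycle_eq_one φ, one_mul] <;> simp

theorem cocycle_S_mul (γ : SL(2, ℤ)) (p q : ℤ) :
    cocycle φ (ModularGroup.S * γ) p q = cocycle φ ModularGroup.S p q * cocycle φ γ (-q) p := by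
  rw [cocycle_mul φ] <;> simp [ModularGroup.coe_S]

theorem isReciprocityFunction_reciprocityFunction (hw : Even w) :
    IsReciprocityFunction (reciprocityFunction w φ) where
  neg_right p q h := by
    rw [reciprocityFunction_mk, reciprocityFunction_mk, ← cocycle_neg_neg φ hw, neg_neg]
  mul_rot p q h := by
    -- The product is the cocycle at `S * S`, which fixes `i∞`.
    rw [reciprocityFunction_mk, reciprocityFunction_mk, ← cocycle_S_mul, cocycle_eq_one φ]
    simp [ModularGroup.coe_S, Matrix.mul_apply]
  mul_add p q h := by
    -- The left side becomes the cocycle at `S T⁻¹ S`, the right side the cocycle at `T S`, both at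
    -- `(p, p + q)`. Both matrices send `i∞` to `1`.
    rw [reciprocityFunction_mk, reciprocityFunction_mk, reciprocityFunction_mk,
      ← cocycle_neg_neg φ hw _ (p + q) q, show -q = p + -(p + q) by ring,
      ← cocycle_T_inv_mul, ← cocycle_S_mul, ← cocycle_T_mul φ ModularGroup.S p q,
      add_comm q p]
    apply cocycle_congr <;>
      simp [ModularGroup.coe_S, ModularGroup.coe_T, Matrix.mul_apply]

theorem isDedekindSymbol_dedekindSymbol (hw : Even w) :
    IsDedekindSymbol (reciprocityFunction w φ) (dedekindSymbol w φ) where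
  isReciprocityFunction := isReciprocityFunction_reciprocityFunction φ hw
  add_right p q h := by
    obtain ⟨γ, h0, h1⟩ := exists_SL2_of_gcd h
    rw [dedekindSymbol_mk φ h h0 h1, ← cocycle_T_mul, ← dedekindSymbol_mk φ (gcd_add_right' h)] <;>
      simp [ModularGroup.coe_T, Matrix.mul_apply, Fin.sum_univ_two, h0, h1]
  neg_right p q h := by
    change J (Omega w φ p (-q)) (cusp p (-q)) = J (Omega w φ (-p) q) (cusp (-p) q)
    rw [← cusp_neg_neg, ← Omega_neg_neg φ hw, neg_neg]
  reciprocity p q h := by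
    obtain ⟨γ, h0, h1⟩ := exists_SL2_of_gcd h
    have hD : dedekindSymbol w φ (W.mk q (-p) (gcd_swap_neg h)) =
        cocycle φ (ModularGroup.S * γ) q (-p) := by
      apply dedekindSymbol_mk <;>
        simp [ModularGroup.coe_S, Matrix.mul_apply, Fin.sum_univ_two, h0, h1]
    -- After a sign change, `f(p,q) D(q,-p)` is the cocycle at `S * (S * γ)`; since `S² = -1`, its
    -- cusp is that of `γ`.
    rw [hD, dedekindSymbol_mk φ h h0 h1, reciprocityFunction_mk, mul_inv_eq_iff_eq_mul,
      ← cocycle_neg_neg φ hw _ q, neg_neg, ← cocycle_S_mul]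
    symm
    apply cocycle_congr <;>
      simp [ModularGroup.coe_S, Matrix.vecMul, dotProduct, Fin.sum_univ_two]

end Cocycle

end NCDedekind

end

theorem theorem2p2 (w r : ℕ) (hw : Even w)
    (φ : Module.Basis (Fin r) ℂ (CuspForm 𝒮ℒ ((w : ℤ) + 2))) :
    (∀ (p q : ℤ), Int.gcd p q = 1 → ∀ x : ℚ, NCDedekind.Converges (NCDedekind.Omega w φ p q) x) ∧
    NCDedekind.IsReciprocityFunction (NCDedekind.reciprocityFunction w φ) ∧
    NCDedekind.IsDedekindSymbol
      (NCDedekind.reciprocityFunction w φ) (NCDedekind.dedekindSymbol w φ) :=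
  ⟨fun p q _ x => NCDedekind.converges_Omega φ p q x,
    NCDedekind.isReciprocityFunction_reciprocityFunction φ hw,
    NCDedekind.isDedekindSymbol_dedekindSymbol φ hw⟩
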